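/- Consider $n$ agents with translations $T_i(t)\in\mathbb{R}^3$ and rotations $R_i(t)\in SO(3)$, where $\dot T_i = R_i v_i$ and $v_i$ is the control. Let $a_{ij}>0$ ($i,j=1,\dots,n$) be fixed weights. Each agent $i$ has a time-varying neighborhood $\mathcal{N}_i(t)\subseteq\{1,\dots,n\}$, $t\in\mathbb{R}$, with $i\in\mathcal{N}_i(t)$, which is piecewise constant and right-continuous in $t$, and there is $\tau_D>0$ such that any two consecutive switching times of $\mathcal{N}_i$ are more than $\tau_D$ apart, for every $i$ (switching times of different agents may be arbitrarily close). Let $\mathcal{G}(t)$ be the digraph on $\{1,\dots,n\}$ in which $(i,j)$ is an edge if and only if $j\in\mathcal{N}_i(t)$. Suppose that $\mathcal{G}$ is uniformly quasi-strongly connected: there is $S>0$ such that for every $t\in\mathbb{R}$ the union graph $\bigcup_{s\in[t,t+S)}\mathcal{G}(s)$ has a node to which there is a directed path from every other node. Let the controller be $$v_i=\sum_{j\in\mathcal{N}_i(t)}a_{ij}T_{ij},\qquad T_{ij}=R_i^{T}(T_j-T_i).$$ Then, whatever the rotation trajectories $R_i(\cdot)$ are, the closed loop for $T=[T_1^T,\dots,T_n^T]^T\in\mathbb{R}^{3n}$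 is the linear switched system $$\dot T=-(L(t)\otimes I_3)\,T,$$ where $L(t)=D(t)-A(t)$, $A(t)$ has entries $a_{ij}$ if $j\in\mathcal{N}_i(t)$ and $0$ otherwise, and $D(t)$ is the diagonal matrix of the row sums of $A(t)$. Moreover, the consensus set $\mathcal{A}=\{T\in\mathbb{R}^{3n}: T_i=T_j\ \text{for all } i,j\}$ is globally asymptotically stable for this system. That is, with $\|z\|_{\mathcal{A}}=\inf_{w\in\mathcal{A}}\|z-w\|$: for every initial time $t_0\in\mathbb{R}$ and every initial state there is a unique solution on $[t_0,\infty)$; for every $t_0$ and every $\varepsilon>0$ there is $\delta>0$ such that every solution with $\|T(t_0)\|_{\mathcal{A}}\le\delta$ satisfies $\|T(t)\|_{\mathcal{A}}\le\varepsilon$ for all $t\ge t_0$; and every solution satisfies $\|T(t)\|_{\mathcal{A}}\to 0$ as $t\to\infty$. (Solutions are continuous functions of time that satisfy the differential equation with the right derivative at every $t\ge t_0$.) -/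

import Mathlib

open Set Filter Topology
open scoped Kronecker Matrix

namespace TranslationConsensus

/-! ### Time-varying systems and asymptotic stability of sets -/

section Stability

variable {E : Type*} [NormedAddCommGroup E] [NormedSpace ℝ E]

/-- `z` is a (forward complete) solution of `ż = f(t, z)` on `[t₀, ∞)`: it is continuous and its
right derivative at every `t ≥ t₀` is `f t (z t)`. For `f` that is right-continuous and
piecewise constant in `t` this is the usual notion: `z` is continuous, and differentiable with
`ż = f(t, z)` between the switching times. -/
structure IsSolution (f : ℝ → E → E) (t₀ : ℝ) (z : ℝ → E) : Prop where
  continuousOn : ContinuousOn z (Ici t₀)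
  hasDerivWithinAt : ∀ t, t₀ ≤ t → HasDerivWithinAt z (f t (z t)) (Ici t) t

/-- For all initial data `(t₀, z₀)` the solution exists on all of `[t₀, ∞)` and is unique. -/
def HasUniqueSolutions (f : ℝ → E → E) : Prop :=
  ∀ (t₀ : ℝ) (z₀ : E), ∃ z : ℝ → E, IsSolution f t₀ z ∧ z t₀ = z₀ ∧
    ∀ w : ℝ → E, IsSolution f t₀ w → w t₀ = z₀ → EqOn w z (Ici t₀)

/-- The set `D` is stable: solutions starting close to `D` stay close to `D`. -/
def IsStableSet (f : ℝ → E → E) (D : Set E) : Prop :=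
  ∀ t₀ : ℝ, ∀ ε > 0, ∃ δ > 0, ∀ z : ℝ → E, IsSolution f t₀ z →
    Metric.infDist (z t₀) D ≤ δ → ∀ t, t₀ ≤ t → Metric.infDist (z t) D ≤ ε

/-- The set `D` is globally attractive: every solution approaches `D`. -/
def IsGloballyAttractiveSet (f : ℝ → E → E) (D : Set E) : Prop :=
  ∀ (t₀ : ℝ) (z : ℝ → E), IsSolution f t₀ z →
    Tendsto (fun t => Metric.infDist (z t) D) atTop (𝓝 0)

/-- The set `D` is globally asymptotically stable for `ż = f(t, z)`: the system has unique forward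
complete solutions for all initial data, and `D` is stable and globally attractive. -/
structure IsGloballyAsymptoticallyStable (f : ℝ → E → E) (D : Set E) : Prop where
  hasUniqueSolutions : HasUniqueSolutions f
  stable : IsStableSet f D
  attractive : IsGloballyAttractiveSet f D

end Stability

/-! ### Switching signals and graphs -/

/-- `t` is a switching time (a discontinuity) of a signal `s` with values in a discrete set. -/
def IsSwitchTime {α : Type*} (s : ℝ → α) (t : ℝ) : Prop :=
  ¬ ∀ᶠ u in 𝓝 t, s u = s t

/-- `s` is a right-continuous switching signal for which any two switching times are more than `τ`
apart. For `τ > 0` such a signal is piecewise constant: it is locally constant, hence constant,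
between two consecutive switching times. -/
structure IsSwitchingSignal {α : Type*} (s : ℝ → α) (τ : ℝ) : Prop where
  rightContinuous : ∀ t, ∀ᶠ u in 𝓝[≥] t, s u = s t
  dwell : ∀ t₁ t₂, IsSwitchTime s t₁ → IsSwitchTime s t₂ → t₁ < t₂ → τ < t₂ - t₁

/-- The possible neighbourhoods of agent `i`: the sets of agents that contain `i`. -/
abbrev Neighborhood {n : ℕ} (i : Fin n) : Type := {N : Finset (Fin n) // i ∈ N}

/-- The digraph with an edge `(i, j)` if and only if `j` is a neighbour of `i`. -/
def neighborGraph {n : ℕ} (N : ∀ i : Fin n, Neighborhood i) : Digraph (Fin n) where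
  Adj i j := j ∈ (N i).1

/-- The union over `t ∈ [t₁, t₂)` of the neighbourhood graphs given by the signals `σ`. -/
def unionGraph {n : ℕ} (σ : ∀ i : Fin n, ℝ → Neighborhood i) (t₁ t₂ : ℝ) : Digraph (Fin n) where
  Adj i j := ∃ t ∈ Ico t₁ t₂, (neighborGraph fun k => σ k t).Adj i j

/-- There is a center: a node to which there is a directed path from every node. -/
def IsQuasiStronglyConnected {n : ℕ} (G : Digraph (Fin n)) : Prop :=
  ∃ c, ∀ i, Relation.ReflTransGen G.Adj i c

/-- For some `S > 0`, the union graph over `[t, t + S)` is quasi-strongly connected for all `t`. -/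
def IsUniformlyQuasiStronglyConnected {n : ℕ} (σ : ∀ i : Fin n, ℝ → Neighborhood i) : Prop :=
  ∃ S > 0, ∀ t : ℝ, IsQuasiStronglyConnected (unionGraph σ t (t + S))

/-- The adjacency matrix of the neighbourhood graph: `a i j` on edges and `0` elsewhere. -/
def adjacency {n : ℕ} (a : Matrix (Fin n) (Fin n) ℝ) (N : ∀ i : Fin n, Neighborhood i) :
    Matrix (Fin n) (Fin n) ℝ :=
  Matrix.of fun i j => if j ∈ (N i).1 then a i j else 0

/-- The graph Laplacian `D - A`, where `D` is the diagonal matrix of the row sums of `A`. -/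
def laplacian {n : ℕ} (A : Matrix (Fin n) (Fin n) ℝ) : Matrix (Fin n) (Fin n) ℝ :=
  Matrix.diagonal (fun i => ∑ j, A i j) - A

/-! ### Translations and their control -/

/-- `ℝ³ⁿ` with the Euclidean norm; coordinate `(i, k)` is the `k`-th coordinate of agent `i`. -/
abbrev TotalTranslation (n : ℕ) : Type := EuclideanSpace ℝ (Fin n × Fin 3)

/-- The translation `T_i ∈ ℝ³` of agent `i`. -/
def translation {n : ℕ} (T : TotalTranslation n) (i : Fin n) : Fin 3 → ℝ :=
  fun k => T (i, k)

/-- The relative translation `T_ij = R_iᵀ (T_j - T_i)`. -/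
def relTranslation {n : ℕ} (R : Fin n → Matrix.specialOrthogonalGroup (Fin 3) ℝ)
    (T : TotalTranslation n) (i j : Fin n) : Fin 3 → ℝ :=
  (R i : Matrix (Fin 3) (Fin 3) ℝ)ᵀ *ᵥ (translation T j - translation T i)

/-- The controller `v_i = ∑_{j ∈ N_i} a_ij T_ij`. -/
def linearVelocity {n : ℕ} (a : Matrix (Fin n) (Fin n) ℝ) (N : ∀ i : Fin n, Neighborhood i)
    (R : Fin n → Matrix.specialOrthogonalGroup (Fin 3) ℝ) (T : TotalTranslation n) (i : Fin n) :
    Fin 3 → ℝ :=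
  ∑ j ∈ (N i).1, a i j • relTranslation R T i j

/-- The right-hand side, at time `t` and state `T`, of the kinematics `Ṫ_i = R_i(t) v_i`
(`i = 1, …, n`) in closed loop with the controller, along the rotation trajectories `R`. -/
noncomputable def closedLoop {n : ℕ} (a : Matrix (Fin n) (Fin n) ℝ)
    (σ : ∀ i : Fin n, ℝ → Neighborhood i)
    (R : ℝ → Fin n → Matrix.specialOrthogonalGroup (Fin 3) ℝ) (t : ℝ) (T : TotalTranslation n) :
    TotalTranslation n :=
  WithLp.toLp 2 fun p =>
    ((R t p.1 : Matrix (Fin 3) (Fin 3) ℝ) *ᵥ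
      linearVelocity a (fun i => σ i t) (R t) T p.1) p.2

/-- The consensus set: all translations are equal. -/
def consensusSet (n : ℕ) : Set (TotalTranslation n) :=
  {z | ∀ i j, translation z i = translation z j}

end TranslationConsensus

open TranslationConsensus

namespace TranslationConsensus

/-! ### Switching signals -/

section Signals

variable {α : Type*} {s : ℝ → α}

/-! Since `R_i R_iᵀ = 1`, the rotations cancel, and each of the three coordinates obeys the scalar
dynamics `ẏᵢ = ∑ⱼ Aᵢⱼ(t) (yⱼ - yᵢ)` with bounded nonnegative weights. Any interval containing all
states is invariant (`IsConsensusSolution.mem_Icc`), which gives stability.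

For attractivity, split time into windows of length `S + τ`. If a set `P` of agents contains the
center of a window and is not everything, a path to the center enters `P`, so some agent outside `P`
has a neighbour in `P`; the dwell time makes this edge last `τ / 2` (`exists_forall_hasInflow`). A
lower bound valid on `P` therefore spreads to one more agent, at the cost of a fixed factor
(`exists_superset_of_window`). The center may vary between windows, but among `n²` windows one agent
is the center at least `n` times (`exists_frequent_center`). If that agent starts in the upper half
of the interval of states, its bound reaches all agents and the lower end rises; otherwise
reflection lowers the upper end. Thus the interval shrinks by a fixed ratio (`contraction`), and
iterating gives consensus.

Existence comes from gluing matrix exponentials over finitely many pieces, uniqueness from a uniform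
Lipschitz constant. -/

lemma eq_of_forall_not_isSwitchTime (hr : ∀ t, ∀ᶠ u in 𝓝[≥] t, s u = s t) {x y : ℝ}
    (h : ∀ u ∈ Ioc x y, ¬ IsSwitchTime s u) : ∀ u ∈ Icc x y, s u = s x := by
  intro u hu
  -- With the discrete topology, locally constant means continuous, and a continuous map on an
  -- interval is constant. A switch at `x` itself is harmless by right-continuity.
  let _ : TopologicalSpace α := ⊥
  have : DiscreteTopology α := ⟨rfl⟩
  refine (isPreconnected_Icc (a := x) (b := y)).constant (f := s) ?_ hu
    (left_mem_Icc.2 (hu.1.trans hu.2))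
  intro v hv
  rw [ContinuousWithinAt, nhds_discrete, tendsto_pure]
  rcases eq_or_lt_of_le hv.1 with rfl | hlt
  · exact (hr x).filter_mono (nhdsWithin_mono _ Icc_subset_Ici_self)
  · have := h v ⟨hlt, hv.2⟩
    rw [IsSwitchTime, not_not] at this
    exact this.filter_mono nhdsWithin_le_nhds

/-- A switch within `τ / 2` after `x` excludes any in `(x - τ / 2, x]`. So every value persists for
time `τ / 2` on one side. -/
lemma IsSwitchingSignal.eq_on_right_or_left {τ : ℝ} (hs : IsSwitchingSignal s τ) (x : ℝ) :
    (∀ u ∈ Icc x (x + τ / 2), s u = s x) ∨ (∀ u ∈ Icc (x - τ / 2) x, s u = s x) := by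
  by_cases h : ∀ u ∈ Ioc x (x + τ / 2), ¬ IsSwitchTime s u
  · exact Or.inl (eq_of_forall_not_isSwitchTime hs.rightContinuous h)
  · right
    push Not at h
    obtain ⟨w, hw, hsw⟩ := h
    have key := eq_of_forall_not_isSwitchTime hs.rightContinuous (x := x - τ / 2) (y := x)
      (fun u hu hsu => by
        have := hs.dwell u w hsu hsw (by linarith [hu.2, hw.1])
        linarith [hu.1, hw.2])
    intro u hu
    rw [key u hu, key x ⟨hu.1.trans hu.2, le_rfl⟩]

/-- If switching times accumulated at `x` from the left, two of them would lie in `(x - τ, x)`. -/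
lemma IsSwitchingSignal.eventually_left {τ : ℝ} (hτ : 0 < τ) (hs : IsSwitchingSignal s τ)
    (x : ℝ) : ∃ c, ∀ᶠ u in 𝓝[<] x, s u = c := by
  obtain ⟨y, hy, h⟩ : ∃ y < x, ∀ u ∈ Ioo y x, ¬ IsSwitchTime s u := by
    by_contra! hcon
    obtain ⟨u, hu, hsu⟩ := hcon (x - τ) (by linarith)
    obtain ⟨w, hw, hsw⟩ := hcon u hu.2
    linarith [hs.dwell u w hsu hsw hw.1, hu.1, hw.2]
  refine ⟨s ((x + y) / 2), ?_⟩
  filter_upwards [Ioo_mem_nhdsLT (show (x + y) / 2 < x by linarith)] with u hu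
  exact eq_of_forall_not_isSwitchTime hs.rightContinuous (x := (x + y) / 2) (y := u)
    (fun v hv => h v ⟨by linarith [hv.1], by linarith [hv.2, hu.2]⟩) u ⟨hu.1.le, le_rfl⟩

end Signals

/-! ### Linear systems with piecewise constant coefficients -/

section LinearSystems

variable {E : Type*} [NormedAddCommGroup E] [NormedSpace ℝ E]

/-- `z` is a solution of `ż = f(t, z)` on `[a, b]`, in the sense of right derivatives. -/
structure IsSolutionOn (f : ℝ → E → E) (a b : ℝ) (z : ℝ → E) : Prop where
  continuousOn : ContinuousOn z (Icc a b)
  hasDerivWithinAt : ∀ t ∈ Ico a b, HasDerivWithinAt z (f t (z t)) (Ici t) t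

lemma IsSolutionOn.mono {f : ℝ → E → E} {a b c : ℝ} {z : ℝ → E} (h : IsSolutionOn f a c z)
    (hbc : b ≤ c) : IsSolutionOn f a b z :=
  ⟨h.continuousOn.mono (Icc_subset_Icc_right hbc),
    fun t ht => h.hasDerivWithinAt t ⟨ht.1, ht.2.trans_le hbc⟩⟩

lemma IsSolution.isSolutionOn {f : ℝ → E → E} {a : ℝ} {z : ℝ → E} (h : IsSolution f a z)
    (b : ℝ) : IsSolutionOn f a b z :=
  ⟨h.continuousOn.mono Icc_subset_Ici_self, fun t ht => h.hasDerivWithinAt t ht.1⟩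

/-- All initial value problems at time `a` are solvable on `[a, b]`. -/
def IsSolvableOn (f : ℝ → E → E) (a b : ℝ) : Prop :=
  ∀ z₀, ∃ z, IsSolutionOn f a b z ∧ z a = z₀

lemma isSolvableOn_refl (f : ℝ → E → E) (a : ℝ) : IsSolvableOn f a a := fun z₀ =>
  ⟨fun _ => z₀, ⟨continuousOn_const, fun _ ht => absurd (ht.1.trans_lt ht.2) (lt_irrefl _)⟩, rfl⟩

lemma IsSolvableOn.trans {f : ℝ → E → E} {a b c : ℝ} (hab : a ≤ b) (hbc : b ≤ c)
    (h₁ : IsSolvableOn f a b) (h₂ : IsSolvableOn f b c) : IsSolvableOn f a c := by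
  intro z₀
  obtain ⟨x, hx, hxa⟩ := h₁ z₀
  obtain ⟨y, hy, hyb⟩ := h₂ (x b)
  set z : ℝ → E := fun t => if t ≤ b then x t else y t with hz
  have zx : ∀ t ≤ b, z t = x t := fun t ht => if_pos ht
  have zy : ∀ t, b ≤ t → z t = y t := by
    intro t ht
    rcases ht.eq_or_lt with rfl | hlt
    · rw [zx _ le_rfl, hyb]
    · exact if_neg (not_le.2 hlt)
  refine ⟨z, ⟨?_, ?_⟩, by rw [zx a hab, hxa]⟩
  · rw [← Icc_union_Icc_eq_Icc hab hbc]
    exact (hx.continuousOn.congr fun t ht => zx t ht.2).union_of_isClosed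
      (hy.continuousOn.congr fun t ht => zy t ht.1) isClosed_Icc isClosed_Icc
  · intro t ht
    rcases lt_or_ge t b with htb | htb
    · rw [zx t htb.le]
      refine (hx.hasDerivWithinAt t ⟨ht.1, htb⟩).congr_of_eventuallyEq ?_ (zx t htb.le)
      filter_upwards [mem_nhdsWithin_of_mem_nhds (Iio_mem_nhds htb)] with u hu
      exact zx u (le_of_lt hu)
    · rw [zy t htb]
      exact (hy.hasDerivWithinAt t ⟨htb, ht.2⟩).congr (fun u hu => zy u (htb.trans hu)) (zy t htb)

lemma IsSolutionOn.eqOn_of_lipschitzWith {f : ℝ → E → E} {K : NNReal}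
    (hf : ∀ t, LipschitzWith K (f t)) {a b : ℝ} {z w : ℝ → E} (hz : IsSolutionOn f a b z)
    (hw : IsSolutionOn f a b w) (h : z a = w a) : EqOn z w (Icc a b) :=
  ODE_solution_unique hf hz.continuousOn hz.hasDerivWithinAt hw.continuousOn hw.hasDerivWithinAt h

lemma hasUniqueSolutions_of_isSolvableOn {f : ℝ → E → E} {K : NNReal}
    (hf : ∀ t, LipschitzWith K (f t)) (hs : ∀ a b, a ≤ b → IsSolvableOn f a b) :
    HasUniqueSolutions f := by
  intro t₀ z₀
  have h : ∀ b : ℝ, ∃ z, IsSolutionOn f t₀ (max t₀ b) z ∧ z t₀ = z₀ := fun b =>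
    hs _ _ (le_max_left _ _) z₀
  choose x hx hx0 using h
  -- The horizon `t + 1` leaves room to the right of `t`, where the right derivative is taken;
  -- uniqueness makes the choice of horizon irrelevant.
  set z : ℝ → E := fun t => x (t + 1) t with hz
  have hzx : ∀ b, ∀ t ∈ Icc t₀ b, z t = x b t := by
    intro b t ht
    have htb : t ≤ min (t + 1) b := le_min (by linarith) ht.2
    have e1 := (hx (t + 1)).mono (b := min (t + 1) b) (le_max_of_le_right (min_le_left _ _))
    have e2 := (hx b).mono (b := min (t + 1) b) (le_max_of_le_right (min_le_right _ _))
    exact e1.eqOn_of_lipschitzWith hf e2 ((hx0 _).trans (hx0 _).symm) ⟨ht.1, htb⟩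
  refine ⟨z, ⟨?_, ?_⟩, hx0 _, ?_⟩
  · intro t ht
    have ht' : t₀ ≤ t := ht
    have hc := (hx (t + 1)).continuousOn t ⟨ht, le_max_of_le_right (by linarith)⟩
    have hc' : ContinuousWithinAt (x (t + 1)) (Ici t₀) t :=
      hc.mono_of_mem_nhdsWithin (by
        filter_upwards [self_mem_nhdsWithin,
          mem_nhdsWithin_of_mem_nhds (Iio_mem_nhds (show t < t + 1 by linarith))] with u hu hu'
        exact ⟨hu, le_max_of_le_right (le_of_lt hu')⟩)
    refine hc'.congr_of_eventuallyEq ?_ rfl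
    filter_upwards [self_mem_nhdsWithin,
      mem_nhdsWithin_of_mem_nhds (Iio_mem_nhds (show t < t + 1 by linarith))] with u hu hu'
    exact hzx _ u ⟨hu, le_of_lt hu'⟩
  · intro t ht
    have hd := (hx (t + 1)).hasDerivWithinAt t ⟨ht, lt_max_of_lt_right (by linarith)⟩
    refine hd.congr_of_eventuallyEq ?_ rfl
    filter_upwards [self_mem_nhdsWithin,
      mem_nhdsWithin_of_mem_nhds (Iio_mem_nhds (show t < t + 1 by linarith))] with u hu hu'
    exact hzx _ u ⟨ht.trans hu, le_of_lt hu'⟩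
  · intro w hw hw0 t ht
    have ht' : t₀ ≤ t := ht
    exact (hw.isSolutionOn (max t₀ (t + 1))).eqOn_of_lipschitzWith hf (hx (t + 1))
      (hw0.trans (hx0 _).symm) ⟨ht, le_max_of_le_right (by linarith)⟩

variable [CompleteSpace E]

lemma isSolvableOn_of_const {A : ℝ → E →L[ℝ] E} {B : E →L[ℝ] E} {a b : ℝ}
    (h : ∀ t ∈ Ico a b, A t = B) : IsSolvableOn (fun t z => A t z) a b := by
  intro z₀
  have hd : ∀ t, HasDerivAt (fun t : ℝ => NormedSpace.exp ((t - a) • B) z₀)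
      (B (NormedSpace.exp ((t - a) • B) z₀)) t := by
    intro t
    have h1 := (hasDerivAt_exp_smul_const' (𝕂 := ℝ) B (t - a)).comp_sub_const t a
    exact h1.clm_apply (hasDerivAt_const t z₀) |>.congr_deriv (by simp)
  refine ⟨_, ⟨fun t _ => (hd t).continuousAt.continuousWithinAt, fun t ht => ?_⟩, ?_⟩
  · rw [h t ht]
    exact (hd t).hasDerivWithinAt
  · simp

/-- Near each point the coefficient takes one value on the left and one on the right, so two
exponentials glue to a local solution. Compactness of `[a, b]` leaves finitely many such pieces. -/
lemma isSolvableOn_of_piecewise_const {A : ℝ → E →L[ℝ] E}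
    (hr : ∀ t, ∀ᶠ u in 𝓝[≥] t, A u = A t) (hl : ∀ t, ∃ B, ∀ᶠ u in 𝓝[<] t, A u = B)
    {a b : ℝ} (hab : a ≤ b) : IsSolvableOn (fun t z => A t z) a b := by
  have hloc : ∀ x : ℝ, ∃ l u : ℝ, l < x ∧ x < u ∧ (∀ c d, l < c → c ≤ d → d < u →
      IsSolvableOn (fun t z => A t z) c d) := by
    intro x
    obtain ⟨B, hB⟩ := hl x
    obtain ⟨l, hlx, hl'⟩ := mem_nhdsLT_iff_exists_Ioo_subset.1 hB
    obtain ⟨u, hux, hu'⟩ := mem_nhdsGE_iff_exists_Ico_subset.1 (hr x)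
    refine ⟨l, u, hlx, hux, fun c d hc hcd hd => ?_⟩
    have left : ∀ d' ≤ x, IsSolvableOn (fun t z => A t z) c d' := fun d' hd' =>
      isSolvableOn_of_const (B := B) fun t ht => hl' ⟨hc.trans_le ht.1, ht.2.trans_le hd'⟩
    have right : ∀ c' ≥ x, IsSolvableOn (fun t z => A t z) c' d := fun c' hc' =>
      isSolvableOn_of_const (B := A x) fun t ht => hu' ⟨le_trans hc' ht.1, ht.2.trans hd⟩
    rcases le_total d x with hdx | hdx
    · exact left d hdx
    rcases le_total x c with hxc | hxc
    · exact right c hxc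
    exact (left x le_rfl).trans hxc hdx (right x le_rfl)
  choose l u hlx hxu hP using hloc
  obtain ⟨t, ht0, hmono, ⟨m, hm⟩, hsub⟩ := exists_monotone_Icc_subset_open_cover_Icc hab
    (c := fun x : ℝ => {y : Icc a b | (y : ℝ) ∈ Ioo (l x) (u x)})
    (fun x => isOpen_Ioo.preimage continuous_subtype_val)
    (fun y _ => mem_iUnion.2 ⟨y, hlx _, hxu _⟩)
  have hstep : ∀ k, IsSolvableOn (fun t z => A t z) a (t k) := by
    intro k
    induction k with
    | zero => rw [ht0]; exact isSolvableOn_refl _ _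
    | succ k ih =>
      obtain ⟨x, hx⟩ := hsub k
      have hle : t k ≤ t (k + 1) := hmono k.le_succ
      exact ih.trans (t k).2.1 hle (hP x _ _ (hx (left_mem_Icc.2 hle)).1 hle
        (hx (right_mem_Icc.2 hle)).2)
  rw [← hm m le_rfl]
  exact hstep m

end LinearSystems

/-! ### Scalar consensus dynamics -/

lemma hasDerivAt_max_zero_sq (x : ℝ) :
    HasDerivAt (fun y : ℝ => max y 0 ^ 2) (2 * max x 0) x := by
  rcases lt_trichotomy x 0 with hx | rfl | hx
  · rw [max_eq_right hx.le, mul_zero]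
    refine (hasDerivAt_const x (0 : ℝ)).congr_of_eventuallyEq ?_
    filter_upwards [Iio_mem_nhds hx] with y hy
    simp [max_eq_right (le_of_lt (mem_Iio.1 hy))]
  · rw [max_self, mul_zero, hasDerivAt_iff_isLittleO]
    have h : (fun y : ℝ => y ^ 2) =o[𝓝 0] fun y => y := by
      simpa using Asymptotics.isLittleO_pow_pow (𝕜 := ℝ) (m := 1) (n := 2) (by norm_num)
    refine (Asymptotics.IsBigO.of_bound 1 ?_ |>.trans_isLittleO h).congr_right (by simp)
    refine Eventually.of_forall fun y => ?_
    have h1 : max y 0 ^ 2 ≤ y ^ 2 := by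
      rcases le_total y 0 with hy | hy
      · simpa [max_eq_right hy] using sq_nonneg y
      · rw [max_eq_left hy]
    simpa using h1
  · rw [max_eq_left hx.le]
    have h := hasDerivAt_pow 2 x
    refine (h.congr_deriv (by simp)).congr_of_eventuallyEq ?_
    filter_upwards [Ioi_mem_nhds hx] with y hy
    rw [max_eq_left (le_of_lt (mem_Ioi.1 hy))]

lemma exp_mul_add_le_of_deriv_right {y y' : ℝ → ℝ} {K c a b : ℝ} (hab : a ≤ b)
    (hy : ContinuousOn y (Icc a b)) (hy' : ∀ t ∈ Ico a b, HasDerivWithinAt y (y' t) (Ici t) t)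
    (hc : ∀ t ∈ Ico a b, c ≤ Real.exp (K * t) * (y' t + K * y t)) :
    Real.exp (K * a) * y a + c * (b - a) ≤ Real.exp (K * b) * y b := by
  have hexp : ∀ t, HasDerivAt (fun t => Real.exp (K * t)) (Real.exp (K * t) * K) t := fun t => by
    simpa using ((hasDerivAt_id t).const_mul K).exp
  have hlin : ∀ t, HasDerivAt (fun t => Real.exp (K * a) * y a + c * (t - a)) c t := fun t => by
    simpa using (((hasDerivAt_id t).sub_const a).const_mul c).const_add (Real.exp (K * a) * y a)
  exact image_le_of_deriv_right_le_deriv_boundary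
    (fun t _ => (hlin t).continuousAt.continuousWithinAt) (fun t _ => (hlin t).hasDerivWithinAt)
    (B := fun t => Real.exp (K * t) * y t)
    (B' := fun t => Real.exp (K * t) * K * y t + Real.exp (K * t) * y' t) (by simp)
    (ContinuousOn.mul (fun t _ => (hexp t).continuousAt.continuousWithinAt) hy)
    (fun t ht => (hexp t).hasDerivWithinAt.mul (hy' t ht))
    (fun t ht => (hc t ht).trans_eq (by ring)) ⟨hab, le_rfl⟩

section ConsensusDynamics

variable {ι : Type*} [Fintype ι]

/-- `y` solves the scalar consensus dynamics `ẏᵢ = ∑ⱼ Aᵢⱼ(t) (yⱼ - yᵢ)` on `[t₀, ∞)`. -/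
structure IsConsensusSolution (A : ℝ → ι → ι → ℝ) (t₀ : ℝ) (y : ι → ℝ → ℝ) : Prop where
  continuousOn : ∀ i, ContinuousOn (y i) (Ici t₀)
  hasDerivWithinAt : ∀ i t, t₀ ≤ t →
    HasDerivWithinAt (y i) (∑ j, A t i j * (y j t - y i t)) (Ici t) t

namespace IsConsensusSolution

variable {A : ℝ → ι → ι → ℝ} {t₀ : ℝ} {y : ι → ℝ → ℝ}

lemma mono (h : IsConsensusSolution A t₀ y) {t₁ : ℝ} (ht : t₀ ≤ t₁) :
    IsConsensusSolution A t₁ y :=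
  ⟨fun i => (h.continuousOn i).mono (Ici_subset_Ici.2 ht),
    fun i t ht' => h.hasDerivWithinAt i t (ht.trans ht')⟩

lemma sub_const (h : IsConsensusSolution A t₀ y) (m : ℝ) :
    IsConsensusSolution A t₀ fun i t => y i t - m :=
  ⟨fun i => (h.continuousOn i).sub continuousOn_const, fun i t ht => by
    simpa using (h.hasDerivWithinAt i t ht).sub_const m⟩

lemma const_sub (h : IsConsensusSolution A t₀ y) (m : ℝ) :
    IsConsensusSolution A t₀ fun i t => m - y i t :=
  ⟨fun i => continuousOn_const.sub (h.continuousOn i), fun i t ht => by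
    refine ((h.hasDerivWithinAt i t ht).const_sub m).congr_deriv ?_
    rw [← Finset.sum_neg_distrib]
    exact Finset.sum_congr rfl fun j _ => by ring⟩

/-- Grönwall for `V = -∑ max(-yᵢ, 0)²`: squaring makes the negative part differentiable, and `V' ≥
2CV` with `V(t₀) = 0` forces `V = 0`. -/
lemma nonneg (h : IsConsensusSolution A t₀ y) {K : ℝ} (hA : ∀ t i j, 0 ≤ A t i j)
    (hK : ∀ t i j, A t i j ≤ K) (h0 : ∀ i, 0 ≤ y i t₀) {t : ℝ} (ht : t₀ ≤ t) (i : ι) :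
    0 ≤ y i t := by
  set u : ι → ℝ → ℝ := fun i t => max (-y i t) 0 with hu
  have hu0 : ∀ i t, 0 ≤ u i t := fun i t => le_max_right _ _
  set C : ℝ := K * Fintype.card ι
  have hdu : ∀ i t, t₀ ≤ t → HasDerivWithinAt (fun t => -u i t ^ 2)
      (2 * u i t * ∑ j, A t i j * (y j t - y i t)) (Ici t) t := by
    intro i t ht
    have h1 := (h.hasDerivWithinAt i t ht).fun_neg
    have h2 := HasDerivAt.comp_hasDerivWithinAt t (hasDerivAt_max_zero_sq (-y i t)) h1
    exact h2.fun_neg.congr_deriv (by simp only [hu]; ring)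
  have hterm : ∀ t i j, -(K * (u i t ^ 2 + u j t ^ 2)) ≤ 2 * u i t * (A t i j * (y j t - y i t)) := by
    intro t i j
    have h1 : -(u i t * u j t) ≤ u i t * (y j t - y i t) := by
      rcases le_total 0 (y i t) with hi | hi
      · have : u i t = 0 := max_eq_right (by linarith)
        simp [this]
      · have e : u i t = -y i t := max_eq_left (by linarith)
        have e' : -y j t ≤ u j t := le_max_left _ _
        nlinarith [hu0 i t]
    have h2 : A t i j * (u i t ^ 2 + u j t ^ 2) ≤ K * (u i t ^ 2 + u j t ^ 2) :=
      mul_le_mul_of_nonneg_right (hK t i j) (by positivity)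
    have h3 := mul_le_mul_of_nonneg_left h1 (hA t i j)
    have h4 := mul_nonneg (hA t i j) (sq_nonneg (u i t - u j t))
    nlinarith
  have hsum := exp_mul_add_le_of_deriv_right (y := fun t => ∑ i, -u i t ^ 2)
    (y' := fun t => ∑ i, 2 * u i t * ∑ j, A t i j * (y j t - y i t)) (K := -(2 * C)) (c := 0) ht
    (continuousOn_finsetSum _ fun i _ => ((((h.continuousOn i).mono Icc_subset_Ici_self).neg.sup
      continuousOn_const).pow 2).neg)
    (fun t ht => HasDerivWithinAt.fun_sum fun i _ => hdu i t ht.1)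
    (fun t _ => by
      refine mul_nonneg (Real.exp_nonneg _) ?_
      have h1 : ∑ i, ∑ j, -(K * (u i t ^ 2 + u j t ^ 2))
          ≤ ∑ i, 2 * u i t * ∑ j, A t i j * (y j t - y i t) := by
        refine Finset.sum_le_sum fun i _ => ?_
        rw [Finset.mul_sum]
        exact Finset.sum_le_sum fun j _ => hterm t i j
      have h2 : ∑ i, ∑ j, -(K * (u i t ^ 2 + u j t ^ 2)) = 2 * C * ∑ i, -u i t ^ 2 := by
        simp only [mul_add, Finset.sum_neg_distrib, Finset.sum_add_distrib, ← Finset.mul_sum,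
          Finset.sum_const, Finset.card_univ, nsmul_eq_mul, C]
        ring
      linarith)
  have hz : ∀ i, u i t₀ = 0 := fun i => max_eq_right (by linarith [h0 i])
  simp only [hz] at hsum
  have hle : ∑ i, u i t ^ 2 ≤ 0 := by
    have : 0 ≤ ∑ i, -u i t ^ 2 := by
      refine nonneg_of_mul_nonneg_right (a := Real.exp (-(2 * C) * t)) ?_ (Real.exp_pos _)
      simpa using hsum
    simpa using this
  have hui : u i t ^ 2 ≤ 0 :=
    (Finset.single_le_sum (f := fun i => u i t ^ 2) (fun i _ => sq_nonneg _)
      (Finset.mem_univ i)).trans hle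
  have : u i t = 0 := by nlinarith [hu0 i t]
  have : -y i t ≤ u i t := le_max_left _ _
  linarith

lemma mem_Icc (h : IsConsensusSolution A t₀ y) {K m d : ℝ} (hA : ∀ t i j, 0 ≤ A t i j)
    (hK : ∀ t i j, A t i j ≤ K) (h0 : ∀ i, y i t₀ ∈ Icc m (m + d)) {t : ℝ} (ht : t₀ ≤ t) (i : ι) :
    y i t ∈ Icc m (m + d) :=
  ⟨sub_nonneg.1 ((h.sub_const m).nonneg hA hK (fun i => sub_nonneg.2 (h0 i).1) ht i),
    sub_nonneg.1 ((h.const_sub (m + d)).nonneg hA hK (fun i => sub_nonneg.2 (h0 i).2) ht i)⟩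

/-! ### Growth and decay of nonnegative solutions -/

section LowerBounds

variable {K : ℝ} (h : IsConsensusSolution A t₀ y) (hA : ∀ t i j, 0 ≤ A t i j)
  (hK : ∀ t i, ∑ j, A t i j ≤ K) (hy : ∀ i t, t₀ ≤ t → 0 ≤ y i t)
include h hA hK hy

/-- A neighbour `j` whose value is at least `β` pulls `i` up. -/
lemma growth {i j : ι} {α β a b : ℝ} (hα : 0 ≤ α) (hβ : 0 ≤ β) (hK0 : 0 ≤ K) (ha : t₀ ≤ a)
    (hab : a ≤ b) (hij : ∀ t ∈ Ico a b, α ≤ A t i j) (hj : ∀ t ∈ Ico a b, β ≤ y j t) :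
    Real.exp (-(K * (b - a))) * (y i a + α * β * (b - a)) ≤ y i b := by
  -- The row-sum bound gives `yᵢ' + K yᵢ ≥ ∑ⱼ Aᵢⱼ yⱼ ≥ αβ`, so `e^{Kt} yᵢ` grows at rate at least
  -- `e^{Ka} αβ`.
  have key := exp_mul_add_le_of_deriv_right (K := K) (c := Real.exp (K * a) * (α * β)) hab
    ((h.continuousOn i).mono (Icc_subset_Ici_self.trans (Ici_subset_Ici.2 ha)))
    (fun t ht => h.hasDerivWithinAt i t (ha.trans ht.1))
    (fun t ht => by
      have ht0 := ha.trans ht.1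
      have h1 : α * β ≤ ∑ j, A t i j * y j t :=
        (mul_le_mul (hij t ht) (hj t ht) hβ (hA t i j)).trans
          (Finset.single_le_sum (f := fun j => A t i j * y j t)
            (fun j _ => mul_nonneg (hA t i j) (hy j t ht0)) (Finset.mem_univ j))
      have h2 := mul_le_mul_of_nonneg_right (hK t i) (hy i t ht0)
      have h3 : ∑ j, A t i j * (y j t - y i t)
          = ∑ j, A t i j * y j t - (∑ j, A t i j) * y i t := by
        simp only [mul_sub, Finset.sum_sub_distrib, Finset.sum_mul]
      refine mul_le_mul (Real.exp_le_exp.2 (mul_le_mul_of_nonneg_left ht.1 hK0)) ?_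
        (mul_nonneg hα hβ) (Real.exp_nonneg _)
      linarith)
  have e : Real.exp (-(K * (b - a))) = Real.exp (K * a) * (Real.exp (K * b))⁻¹ := by
    rw [← Real.exp_neg, ← Real.exp_add]; ring_nf
  rw [e, mul_right_comm, ← div_eq_mul_inv, div_le_iff₀ (Real.exp_pos _)]
  linarith

lemma decay (hK0 : 0 ≤ K) {i : ι} {a b : ℝ} (ha : t₀ ≤ a) (hab : a ≤ b) :
    Real.exp (-(K * (b - a))) * y i a ≤ y i b := by
  simpa using growth h hA hK hy (i := i) (j := i) (α := 0) (β := 0) le_rfl le_rfl hK0 ha hab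
    (fun t _ => hA t i i) (fun t ht => hy i t (ha.trans ht.1))

end LowerBounds

end IsConsensusSolution

/-- During `[a, b]`, some agent outside `P` has, for a duration `h`, a neighbour in `P` whose weight
is at least `α`. -/
def HasInflow (A : ℝ → ι → ι → ℝ) (α h a b : ℝ) (P : Finset ι) : Prop :=
  ∃ i ∉ P, ∃ j ∈ P, ∃ s, a ≤ s ∧ s + h ≤ b ∧ ∀ t ∈ Ico s (s + h), α ≤ A t i j

/-- The factor by which lower bounds deteriorate during a window of length `W`. -/
noncomputable def windowFactor (K α h W : ℝ) : ℝ :=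
  Real.exp (-(K * W)) ^ 3 * min 1 (α * h)

lemma windowFactor_pos {K α h W : ℝ} (hα : 0 < α) (hh : 0 < h) : 0 < windowFactor K α h W :=
  mul_pos (pow_pos (Real.exp_pos _) 3) (lt_min one_pos (mul_pos hα hh))

lemma windowFactor_le_one {K α h W : ℝ} (hK : 0 ≤ K) (hW : 0 ≤ W) (hα : 0 < α) (hh : 0 < h) :
    windowFactor K α h W ≤ 1 :=
  mul_le_one₀ (pow_le_one₀ (Real.exp_nonneg _)
    (Real.exp_le_one_iff.2 (neg_nonpos.2 (mul_nonneg hK hW))))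
    (le_min zero_le_one (mul_pos hα hh).le) (min_le_left _ _)

namespace IsConsensusSolution

variable {A : ℝ → ι → ι → ℝ} {t₀ : ℝ} {y : ι → ℝ → ℝ}

/-! ### Spreading a lower bound from window to window -/

section Windows

variable {K α h W : ℝ} (hsol : IsConsensusSolution A t₀ y) (hA : ∀ t i j, 0 ≤ A t i j)
  (hK : ∀ t i, ∑ j, A t i j ≤ K) (hy : ∀ i t, t₀ ≤ t → 0 ≤ y i t) (hK0 : 0 ≤ K)
include hsol hA hK hy hK0

lemma windowFactor_mul_le {i : ι} {a β : ℝ} (hW : 0 ≤ W) (hβ : 0 ≤ β) (ha : t₀ ≤ a) (hi : β ≤ y i a) :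
    windowFactor K α h W * β ≤ y i (a + W) := by
  have hg0 := Real.exp_pos (-(K * W))
  have hg1 : Real.exp (-(K * W)) ≤ 1 := Real.exp_le_one_iff.2 (neg_nonpos.2 (mul_nonneg hK0 hW))
  have h1 : windowFactor K α h W ≤ Real.exp (-(K * W)) := by
    refine (mul_le_of_le_one_right (by positivity) (min_le_left _ _)).trans ?_
    exact pow_le_of_le_one hg0.le hg1 (by norm_num)
  have h2 := hsol.decay hA hK hy hK0 (i := i) ha (show a ≤ a + W by linarith)
  rw [add_sub_cancel_left] at h2
  exact (mul_le_mul h1 hi hβ hg0.le).trans h2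

lemma windowFactor_mul_le_of_inflow {i j : ι} {a β s : ℝ} (hα : 0 < α) (hh : 0 < h) (hβ : 0 ≤ β)
    (ha : t₀ ≤ a) (hj : β ≤ y j a) (has : a ≤ s) (hs : s + h ≤ a + W)
    (hij : ∀ t ∈ Ico s (s + h), α ≤ A t i j) :
    windowFactor K α h W * β ≤ y i (a + W) := by
  set g := Real.exp (-(K * W)) with hg
  have hg0 : 0 < g := Real.exp_pos _
  have hexp : ∀ c d, d - c ≤ W → g ≤ Real.exp (-(K * (d - c))) := fun c d hcd =>
    Real.exp_le_exp.2 (neg_le_neg (mul_le_mul_of_nonneg_left hcd hK0))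
  have h1 : ∀ t ∈ Ico s (s + h), g * β ≤ y j t := fun t ht =>
    (mul_le_mul (hexp a t (by linarith [ht.2])) hj hβ (Real.exp_nonneg _)).trans
      (hsol.decay hA hK hy hK0 ha (has.trans ht.1))
  have h2 := hsol.growth hA hK hy hα.le (mul_nonneg hg0.le hβ) hK0 (ha.trans has)
    (show s ≤ s + h by linarith) hij h1
  have h3 := hsol.decay hA hK hy hK0 (i := i) (show t₀ ≤ s + h by linarith) hs
  have h4 : α * (g * β) * h ≤ y i s + α * (g * β) * (s + h - s) := by
    rw [add_sub_cancel_left]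
    linarith [hy i s (ha.trans has)]
  have h5 : 0 ≤ α * (g * β) * h := by positivity
  have h6 := (mul_le_mul (hexp s (s + h) (by linarith)) h4 h5 (Real.exp_nonneg _)).trans h2
  have h7 := (mul_le_mul (hexp (s + h) (a + W) (by linarith)) h6 (by positivity)
    (Real.exp_nonneg _)).trans h3
  refine le_trans ?_ h7
  -- The three factors `g` are the losses of `y j` up to and during the edge, of `y i` during it,
  -- and of `y i` afterwards.
  calc windowFactor K α h W * β ≤ g ^ 3 * (α * h) * β := by
        unfold windowFactor
        gcongr
        exact min_le_right _ _
    _ = g * (g * (α * (g * β) * h)) := by ring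

variable (hα : 0 < α) (hh : 0 < h) (hW : 0 ≤ W)
include hα hh hW

lemma exists_superset_of_window {a β : ℝ} (hβ : 0 ≤ β) (ha : t₀ ≤ a) {P : Finset ι}
    (hin : P ≠ Finset.univ → HasInflow A α h a (a + W) P) (hP : ∀ i ∈ P, β ≤ y i a) :
    ∃ Q : Finset ι, P ⊆ Q ∧ (P = Finset.univ ∨ P.card + 1 ≤ Q.card) ∧
      ∀ i ∈ Q, windowFactor K α h W * β ≤ y i (a + W) := by
  classical
  have hdecay : ∀ i ∈ P, windowFactor K α h W * β ≤ y i (a + W) := fun i hi =>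
    hsol.windowFactor_mul_le hA hK hy hK0 hW hβ ha (hP i hi)
  by_cases hPu : P = Finset.univ
  · exact ⟨P, subset_rfl, Or.inl hPu, hdecay⟩
  obtain ⟨i, hi, j, hj, s, has, hs, hij⟩ := hin hPu
  refine ⟨insert i P, Finset.subset_insert i P, Or.inr (Finset.card_insert_of_notMem hi).ge, ?_⟩
  intro k hk
  rcases Finset.mem_insert.1 hk with rfl | hk
  · exact hsol.windowFactor_mul_le_of_inflow hA hK hy hK0 hα hh hβ ha (hP j hj) has hs hij
  · exact hdecay k hk

/-- Start from `{c₀}`. A window centered at `c₀` enlarges the set unless it is full; in any other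
window the set is kept and only the factor is paid. -/
lemma exists_card_ge_of_windows [DecidableEq ι] {c : ℕ → ι} {c₀ : ι} {β : ℝ} (hβ : 0 ≤ β)
    (hc : ∀ (k : ℕ) (P : Finset ι), c k ∈ P → P ≠ Finset.univ →
      HasInflow A α h (t₀ + k * W) (t₀ + k * W + W) P)
    (h0 : β ≤ y c₀ t₀) (k : ℕ) :
    ∃ P : Finset ι, c₀ ∈ P ∧ (P = Finset.univ ∨ 1 + Nat.count (fun l => c l = c₀) k ≤ P.card) ∧
      ∀ i ∈ P, windowFactor K α h W ^ k * β ≤ y i (t₀ + k * W) := by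
  have hγ : 0 < windowFactor K α h W := windowFactor_pos hα hh
  induction k with
  | zero => exact ⟨{c₀}, by simp, by simp, by simpa using h0⟩
  | succ k ih =>
    obtain ⟨P, hcP, hcard, hP⟩ := ih
    have ha : t₀ ≤ t₀ + k * W := le_add_of_nonneg_right (by positivity)
    have hβ' : 0 ≤ windowFactor K α h W ^ k * β := by positivity
    have e1 : t₀ + ((k + 1 : ℕ) : ℝ) * W = t₀ + k * W + W := by push_cast; ring
    have e2 : windowFactor K α h W ^ (k + 1) * β
        = windowFactor K α h W * (windowFactor K α h W ^ k * β) := by ring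
    rw [e1, e2, Nat.count_succ]
    by_cases hck : c k = c₀
    · obtain ⟨Q, hPQ, hQ, hQy⟩ := hsol.exists_superset_of_window hA hK hy hK0 hα hh hW hβ' ha
        (hc k P (hck ▸ hcP)) hP
      refine ⟨Q, hPQ hcP, ?_, hQy⟩
      rw [if_pos hck]
      rcases hcard with rfl | hcard
      · exact Or.inl (Finset.univ_subset_iff.1 hPQ)
      rcases hQ with rfl | hQ
      · exact Or.inl (Finset.univ_subset_iff.1 hPQ)
      · exact Or.inr (by omega)
    · refine ⟨P, hcP, ?_, fun i hi =>
        hsol.windowFactor_mul_le hA hK hy hK0 hW hβ' ha (hP i hi)⟩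
      simpa [hck] using hcard

lemma le_of_windows [DecidableEq ι] {c : ℕ → ι} {c₀ : ι} {β : ℝ} (hβ : 0 ≤ β)
    (hc : ∀ (k : ℕ) (P : Finset ι), c k ∈ P → P ≠ Finset.univ →
      HasInflow A α h (t₀ + k * W) (t₀ + k * W + W) P)
    (h0 : β ≤ y c₀ t₀) {k : ℕ} (hk : Fintype.card ι ≤ Nat.count (fun l => c l = c₀) k) (i : ι) :
    windowFactor K α h W ^ k * β ≤ y i (t₀ + k * W) := by
  obtain ⟨P, -, hcard, hP⟩ := hsol.exists_card_ge_of_windows hA hK hy hK0 hα hh hW hβ hc h0 k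
  have hPu : P = Finset.univ := by
    rcases hcard with hcard | hcard
    · exact hcard
    · exact absurd P.card_le_univ (by omega)
  exact hP i (hPu ▸ Finset.mem_univ i)

end Windows

lemma exists_frequent_center [DecidableEq ι] (c : ℕ → ι) :
    ∃ c₀, Fintype.card ι ≤ Nat.count (fun l => c l = c₀) (Fintype.card ι * Fintype.card ι) := by
  obtain ⟨c₀, -, hc₀⟩ := Finset.exists_le_card_fiber_of_mul_le_card_of_maps_to
    (s := Finset.range (Fintype.card ι * Fintype.card ι)) (t := Finset.univ) (f := c)
    (n := Fintype.card ι) (fun _ _ => Finset.mem_univ _) ⟨c 0, Finset.mem_univ _⟩ (by simp)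
  exact ⟨c₀, by rwa [Nat.count_eq_card_filter_range]⟩

/-- Over `(card ι)²` windows, the interval occupied by the states shrinks by a fixed factor. -/
lemma contraction {K α h W : ℝ} (hA : ∀ t i j, 0 ≤ A t i j) (hK : ∀ t i, ∑ j, A t i j ≤ K)
    (hK0 : 0 ≤ K) (hα : 0 < α) (hh : 0 < h) (hW : 0 ≤ W)
    (hc : ∀ a, ∃ c, ∀ P : Finset ι, c ∈ P → P ≠ Finset.univ → HasInflow A α h a (a + W) P)
    (hsol : IsConsensusSolution A t₀ y) {m d : ℝ} (hd : 0 ≤ d)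
    (h0 : ∀ i, y i t₀ ∈ Icc m (m + d)) :
    ∃ m', ∀ i, y i (t₀ + (Fintype.card ι * Fintype.card ι : ℕ) * W) ∈
      Icc m' (m' + (1 - windowFactor K α h W ^ (Fintype.card ι * Fintype.card ι) / 2) * d) := by
  classical
  have hK' : ∀ t i j, A t i j ≤ K := fun t i j =>
    (Finset.single_le_sum (f := fun j => A t i j) (fun j _ => hA t i j)
      (Finset.mem_univ j)).trans (hK t i)
  choose c hc using fun k : ℕ => hc (t₀ + k * W)
  obtain ⟨c₀, hc₀⟩ := exists_frequent_center c
  set N := Fintype.card ι * Fintype.card ι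
  have hN : t₀ ≤ t₀ + (N : ℝ) * W := le_add_of_nonneg_right (by positivity)
  -- In the upper half, `y - m` starts with at least `d / 2` at `c₀`; in the lower half, the
  -- reflected solution `m + d - y` does.
  rcases le_total (m + d / 2) (y c₀ t₀) with hle | hle
  · have key := (hsol.sub_const m).le_of_windows hA hK
      (fun i t ht => sub_nonneg.2 (hsol.mem_Icc hA hK' h0 ht i).1) hK0 hα hh hW
      (β := d / 2) (by linarith) hc (c₀ := c₀) (by linarith) hc₀
    refine ⟨m + windowFactor K α h W ^ N * (d / 2), fun i => ⟨by linarith [key i], ?_⟩⟩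
    linarith [(hsol.mem_Icc hA hK' h0 hN i).2]
  · have key := (hsol.const_sub (m + d)).le_of_windows hA hK
      (fun i t ht => sub_nonneg.2 (hsol.mem_Icc hA hK' h0 ht i).2) hK0 hα hh hW
      (β := d / 2) (by linarith) hc (c₀ := c₀) (by linarith) hc₀
    refine ⟨m, fun i => ⟨(hsol.mem_Icc hA hK' h0 hN i).1, ?_⟩⟩
    linarith [key i]

/-- All states approach each other. -/
lemma exists_forall_mem_Icc {K α h W : ℝ} (hA : ∀ t i j, 0 ≤ A t i j)
    (hK : ∀ t i, ∑ j, A t i j ≤ K) (hK0 : 0 ≤ K) (hα : 0 < α) (hh : 0 < h) (hW : 0 ≤ W)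
    (hc : ∀ a, ∃ c, ∀ P : Finset ι, c ∈ P → P ≠ Finset.univ → HasInflow A α h a (a + W) P)
    (hsol : IsConsensusSolution A t₀ y) {ε : ℝ} (hε : 0 < ε) :
    ∃ t₁, ∀ t, t₁ ≤ t → ∃ m, ∀ i, y i t ∈ Icc m (m + ε) := by
  have hK' : ∀ t i j, A t i j ≤ K := fun t i j =>
    (Finset.single_le_sum (f := fun j => A t i j) (fun j _ => hA t i j)
      (Finset.mem_univ j)).trans (hK t i)
  set N := Fintype.card ι * Fintype.card ι
  set ρ := windowFactor K α h W ^ N / 2 with hρ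
  have hγ0 : 0 < windowFactor K α h W ^ N := pow_pos (windowFactor_pos hα hh) N
  have hγ1 : windowFactor K α h W ^ N ≤ 1 :=
    pow_le_one₀ (windowFactor_pos hα hh).le (windowFactor_le_one hK0 hW hα hh)
  set d := 2 * ∑ i, |y i t₀|
  have hd : 0 ≤ d := by positivity
  have hstep : ∀ k : ℕ, ∃ m, ∀ i, y i (t₀ + k * (N * W)) ∈ Icc m (m + (1 - ρ) ^ k * d) := by
    intro k
    induction k with
    | zero =>
      refine ⟨-∑ i, |y i t₀|, fun i => ?_⟩
      have h1 : |y i t₀| ≤ ∑ i, |y i t₀| :=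
        Finset.single_le_sum (f := fun i => |y i t₀|) (fun i _ => abs_nonneg _) (Finset.mem_univ i)
      have h2 := abs_le.1 h1
      simp only [Nat.cast_zero, zero_mul, add_zero, pow_zero, one_mul]
      exact ⟨h2.1, by linarith [h2.2]⟩
    | succ k ih =>
      obtain ⟨m, hm⟩ := ih
      obtain ⟨m', hm'⟩ := contraction hA hK hK0 hα hh hW hc
        (hsol.mono (le_add_of_nonneg_right (by positivity)))
        (mul_nonneg (pow_nonneg (by linarith) k) hd) hm
      refine ⟨m', fun i => ?_⟩
      have e1 : t₀ + ((k + 1 : ℕ) : ℝ) * (N * W) = t₀ + k * (N * W) + N * W := by push_cast; ring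
      have e2 : (1 - ρ) ^ (k + 1) * d = (1 - ρ) * ((1 - ρ) ^ k * d) := by ring
      rw [e1, e2]
      exact hm' i
  have hlim : Tendsto (fun k : ℕ => (1 - ρ) ^ k * d) atTop (𝓝 (0 * d)) :=
    (tendsto_pow_atTop_nhds_zero_of_lt_one (by linarith) (by linarith)).mul_const d
  rw [zero_mul] at hlim
  obtain ⟨k, hk⟩ := (hlim.eventually (gt_mem_nhds hε)).exists
  obtain ⟨m, hm⟩ := hstep k
  refine ⟨t₀ + k * (N * W), fun t ht => ⟨m, fun i => ?_⟩⟩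
  have hmem := (hsol.mono (le_add_of_nonneg_right (by positivity))).mem_Icc hA hK' hm ht i
  exact ⟨hmem.1, hmem.2.trans (by linarith)⟩

end IsConsensusSolution

end ConsensusDynamics

/-! ### The closed loop -/

section ClosedLoop

variable {n : ℕ}

lemma closedLoop_apply (a : Matrix (Fin n) (Fin n) ℝ) (σ : ∀ i : Fin n, ℝ → Neighborhood i)
    (R : ℝ → Fin n → Matrix.specialOrthogonalGroup (Fin 3) ℝ) (t : ℝ) (T : TotalTranslation n)
    (i : Fin n) (k : Fin 3) :
    closedLoop a σ R t T (i, k) =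
      ∑ j, adjacency a (fun i => σ i t) i j * (T (j, k) - T (i, k)) := by
  have hR : (R t i : Matrix (Fin 3) (Fin 3) ℝ) * (R t i : Matrix (Fin 3) (Fin 3) ℝ)ᵀ = 1 :=
    (Matrix.mem_orthogonalGroup_iff (Fin 3) ℝ).1
      (Matrix.mem_specialOrthogonalGroup_iff.1 (R t i).2).1
  simp only [closedLoop, linearVelocity, relTranslation, Matrix.mulVec_sum, Matrix.mulVec_smul,
    Matrix.mulVec_mulVec, hR, Matrix.one_mulVec, Finset.sum_apply, Pi.smul_apply, Pi.sub_apply,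
    smul_eq_mul, translation, adjacency, Matrix.of_apply, ite_mul, zero_mul]
  rw [← Finset.sum_filter]
  exact Finset.sum_congr (by ext; simp) fun _ _ => rfl

lemma neg_laplacian_kronecker_mulVec (A : Matrix (Fin n) (Fin n) ℝ) (x : Fin n × Fin 3 → ℝ)
    (i : Fin n) (k : Fin 3) :
    (-(laplacian A ⊗ₖ (1 : Matrix (Fin 3) (Fin 3) ℝ)) *ᵥ x) (i, k) =
      ∑ j, A i j * (x (j, k) - x (i, k)) := by
  have h : ∀ j, ∑ l, (laplacian A ⊗ₖ (1 : Matrix (Fin 3) (Fin 3) ℝ)) (i, k) (j, l) * x (j, l)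
      = laplacian A i j * x (j, k) := fun j => by
    simp [Matrix.kroneckerMap_apply, Matrix.one_apply]
  rw [Matrix.neg_mulVec, Pi.neg_apply, Matrix.mulVec, dotProduct, Fintype.sum_prod_type]
  simp only [h]
  simp only [laplacian, Matrix.sub_apply, Matrix.diagonal_apply, sub_mul, ite_mul, zero_mul,
    Finset.sum_sub_distrib, Finset.sum_ite_eq, Finset.mem_univ, if_true, mul_sub, Finset.sum_mul]
  ring

/-- The linear map `T ↦ -(L ⊗ I₃) T` that belongs to the neighbourhoods `N`. -/
noncomputable def consensusMap (a : Matrix (Fin n) (Fin n) ℝ) (N : ∀ i : Fin n, Neighborhood i) :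
    TotalTranslation n →L[ℝ] TotalTranslation n :=
  Matrix.toEuclideanCLM (𝕜 := ℝ)
    (-(laplacian (adjacency a N) ⊗ₖ (1 : Matrix (Fin 3) (Fin 3) ℝ)))

lemma closedLoop_eq (a : Matrix (Fin n) (Fin n) ℝ) (σ : ∀ i : Fin n, ℝ → Neighborhood i)
    (R : ℝ → Fin n → Matrix.specialOrthogonalGroup (Fin 3) ℝ) (t : ℝ) (T : TotalTranslation n) :
    closedLoop a σ R t T = WithLp.toLp 2
      (-((laplacian (adjacency a fun i => σ i t)) ⊗ₖ (1 : Matrix (Fin 3) (Fin 3) ℝ)) *ᵥ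
        WithLp.ofLp T) := by
  ext ⟨i, k⟩
  rw [closedLoop_apply]
  exact (neg_laplacian_kronecker_mulVec _ _ i k).symm

lemma hasUniqueSolutions_closedLoop (a : Matrix (Fin n) (Fin n) ℝ)
    {σ : ∀ i : Fin n, ℝ → Neighborhood i} {τ : ℝ} (hτ : 0 < τ)
    (hσ : ∀ i, IsSwitchingSignal (σ i) τ)
    (R : ℝ → Fin n → Matrix.specialOrthogonalGroup (Fin 3) ℝ) :
    HasUniqueSolutions (closedLoop a σ R) := by
  have e : closedLoop a σ R = fun t z => consensusMap a (fun i => σ i t) z := by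
    ext1 t; ext1 z
    exact closedLoop_eq a σ R t z
  rw [e]
  -- Only finitely many neighbourhood configurations exist, so the sum of all norms is a Lipschitz
  -- constant uniform in time.
  refine hasUniqueSolutions_of_isSolvableOn (K := ∑ N, ‖consensusMap a N‖₊) (fun t => ?_)
    (fun b c hbc => isSolvableOn_of_piecewise_const
      (A := fun t => consensusMap a fun i => σ i t) (fun t => ?_) (fun t => ?_) hbc)
  · exact (consensusMap a fun i => σ i t).lipschitz.weaken
      (Finset.single_le_sum (f := fun N => ‖consensusMap a N‖₊) (fun _ _ => zero_le)
        (Finset.mem_univ fun i => σ i t))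
  · filter_upwards [eventually_all.2 fun i => (hσ i).rightContinuous t] with u hu
    rw [funext hu]
  · choose N hN using fun i => (hσ i).eventually_left hτ t
    refine ⟨consensusMap a N, ?_⟩
    filter_upwards [eventually_all.2 hN] with u hu
    rw [funext hu]

lemma isConsensusSolution_of_isSolution {a : Matrix (Fin n) (Fin n) ℝ}
    {σ : ∀ i : Fin n, ℝ → Neighborhood i}
    {R : ℝ → Fin n → Matrix.specialOrthogonalGroup (Fin 3) ℝ} {t₀ : ℝ}
    {z : ℝ → TotalTranslation n} (hz : IsSolution (closedLoop a σ R) t₀ z) (k : Fin 3) :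
    IsConsensusSolution (fun t => adjacency a fun i => σ i t) t₀ fun i t => z t (i, k) where
  continuousOn i := (EuclideanSpace.proj (𝕜 := ℝ) (i, k)).continuous.comp_continuousOn
    hz.continuousOn
  hasDerivWithinAt i t ht := by
    rw [← closedLoop_apply a σ R]
    let π : TotalTranslation n →L[ℝ] ℝ := EuclideanSpace.proj (i, k)
    exact π.hasFDerivAt.comp_hasDerivWithinAt t (hz.hasDerivWithinAt t ht)

/-! ### Connectivity -/

lemma exists_adj_of_reflTransGen {V : Type*} {G : Digraph V} {P : Finset V} {c i : V}
    (h : Relation.ReflTransGen G.Adj i c) (hc : c ∈ P) (hi : i ∉ P) :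
    ∃ i ∉ P, ∃ j ∈ P, G.Adj i j := by
  induction h using Relation.ReflTransGen.head_induction_on with
  | refl => exact absurd hc hi
  | @head i j hij _ ih =>
    by_cases hj : j ∈ P
    · exact ⟨i, hi, j, hj, hij⟩
    · exact ih hj

lemma exists_forall_hasInflow {a : Matrix (Fin n) (Fin n) ℝ} {α τ S : ℝ} (hτ : 0 < τ)
    (ha : ∀ i j, α ≤ a i j)
    {σ : ∀ i : Fin n, ℝ → Neighborhood i} (hσ : ∀ i, IsSwitchingSignal (σ i) τ)
    (hconn : ∀ t, IsQuasiStronglyConnected (unionGraph σ t (t + S))) (b : ℝ) :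
    ∃ c, ∀ P : Finset (Fin n), c ∈ P → P ≠ Finset.univ →
      HasInflow (fun t => adjacency a fun i => σ i t) α (τ / 2) b (b + (S + τ)) P := by
  -- The margins of `τ / 2` at both ends of the window leave room for the edge to persist on either
  -- side of the instant at which it is found.
  obtain ⟨c, hc⟩ := hconn (b + τ / 2)
  refine ⟨c, fun P hcP hP => ?_⟩
  obtain ⟨i₀, hi₀⟩ : ∃ i, i ∉ P := by
    by_contra! hall
    exact hP (Finset.eq_univ_iff_forall.2 hall)
  obtain ⟨i, hi, j, hj, s, hs, hij⟩ := exists_adj_of_reflTransGen (hc i₀) hcP hi₀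
  have hij' : j ∈ (σ i s).1 := hij
  have hadj : ∀ t, σ i t = σ i s → α ≤ adjacency a (fun i => σ i t) i j := by
    intro t ht
    simp only [adjacency, Matrix.of_apply, ht, hij', if_true, ha i j]
  rcases (hσ i).eq_on_right_or_left s with h | h
  · exact ⟨i, hi, j, hj, s, by linarith [hs.1], by linarith [hs.2],
      fun t ht => hadj t (h t ⟨ht.1, ht.2.le⟩)⟩
  · exact ⟨i, hi, j, hj, s - τ / 2, by linarith [hs.1], by linarith [hs.2],
      fun t ht => hadj t (h t ⟨ht.1, by linarith [ht.2]⟩)⟩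

/-! ### The distance to consensus -/

lemma infDist_consensusSet_le {z : TotalTranslation n} {d : ℝ}
    (h : ∀ k, ∃ m, ∀ i, z (i, k) ∈ Icc m (m + d)) :
    Metric.infDist z (consensusSet n) ≤ √(n * 3 * d ^ 2) := by
  choose m hm using h
  have hw : WithLp.toLp 2 (fun p : Fin n × Fin 3 => m p.2) ∈ consensusSet n := fun i j => rfl
  refine (Metric.infDist_le_dist_of_mem hw).trans ?_
  rw [EuclideanSpace.dist_eq]
  refine Real.sqrt_le_sqrt ?_
  calc _ ≤ ∑ _p : Fin n × Fin 3, d ^ 2 := by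
        refine Finset.sum_le_sum fun p _ => ?_
        have h1 := hm p.2 p.1
        rw [Real.dist_eq, sq_abs]
        exact pow_le_pow_left₀ (sub_nonneg.2 h1.1) (by linarith [h1.2]) 2
    _ = n * 3 * d ^ 2 := by simp

lemma exists_mem_Icc_of_infDist_le (c : Fin n) {z : TotalTranslation n} {δ : ℝ} (hδ : 0 < δ)
    (h : Metric.infDist z (consensusSet n) ≤ δ) (k : Fin 3) :
    ∃ m, ∀ i, z (i, k) ∈ Icc m (m + 4 * δ) := by
  have hne : (consensusSet n).Nonempty := ⟨0, fun i j => rfl⟩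
  -- Doubling `δ` gives a strict inequality, hence an actual consensus point; two-sided deviations
  -- of `2δ` explain the width `4δ`.
  obtain ⟨w, hw, hzw⟩ := (Metric.infDist_lt_iff hne).1 (h.trans_lt (by linarith : δ < 2 * δ))
  refine ⟨w (c, k) - 2 * δ, fun i => ?_⟩
  have h1 : |z (i, k) - w (i, k)| ≤ 2 * δ := by
    rw [dist_eq_norm] at hzw
    exact (PiLp.norm_apply_le (z - w) (i, k)).trans hzw.le
  have h2 : w (i, k) = w (c, k) := congrFun (hw i c) k
  rw [h2, abs_le] at h1
  exact ⟨by linarith [h1.1], by linarith [h1.2]⟩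

lemma exists_scale (n : ℕ) {ε : ℝ} (hε : 0 < ε) : ∃ d > 0, √(n * 3 * d ^ 2) ≤ ε := by
  refine ⟨ε / √(n * 3 + 1), by positivity, Real.sqrt_le_iff.2 ⟨hε.le, ?_⟩⟩
  rw [div_pow, Real.sq_sqrt (by positivity), ← mul_div_assoc, div_le_iff₀ (by positivity)]
  nlinarith [sq_nonneg ε]

end ClosedLoop

end TranslationConsensus

open TranslationConsensus
theorem mainTheorem9 (n : ℕ)
    (a : Matrix (Fin n) (Fin n) ℝ) (ha : ∀ i j, 0 < a i j)
    (σ : ∀ i : Fin n, ℝ → Neighborhood i)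
    (hσ : ∃ τ > 0, ∀ i, IsSwitchingSignal (σ i) τ)
    (hconn : IsUniformlyQuasiStronglyConnected σ)
    (R : ℝ → Fin n → Matrix.specialOrthogonalGroup (Fin 3) ℝ) :
    (∀ (t : ℝ) (T : TotalTranslation n),
      closedLoop a σ R t T =
        WithLp.toLp 2
          (-((laplacian (adjacency a fun i => σ i t)) ⊗ₖ (1 : Matrix (Fin 3) (Fin 3) ℝ)) *ᵥ
            WithLp.ofLp T)) ∧
    IsGloballyAsymptoticallyStable (closedLoop a σ R) (consensusSet n) := by
  refine ⟨closedLoop_eq a σ R, ?_⟩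
  obtain ⟨τ, hτ, hσ⟩ := hσ
  obtain ⟨S, hS, hconn⟩ := hconn
  -- The center serves only as a witness that there is an agent, so that a smallest weight exists.
  obtain ⟨c, -⟩ := hconn 0
  have : Nonempty (Fin n × Fin n) := ⟨(c, c)⟩
  obtain ⟨⟨i₀, j₀⟩, hmin⟩ := Finite.exists_min fun p : Fin n × Fin n => a p.1 p.2
  have hα : ∀ i j, a i₀ j₀ ≤ a i j := fun i j => hmin (i, j)
  have hA : ∀ t i j, 0 ≤ adjacency a (fun i => σ i t) i j := fun t i j => by
    rw [adjacency, Matrix.of_apply]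
    split_ifs
    exacts [(ha i j).le, le_rfl]
  have hAa : ∀ t i j, adjacency a (fun i => σ i t) i j ≤ a i j := fun t i j => by
    rw [adjacency, Matrix.of_apply]
    split_ifs
    exacts [le_rfl, (ha i j).le]
  have hrow : ∀ i, 0 ≤ ∑ j, a i j := fun i => Finset.sum_nonneg fun j _ => (ha i j).le
  have hK : ∀ t i, ∑ j, adjacency a (fun i => σ i t) i j ≤ ∑ i, ∑ j, a i j := fun t i =>
    (Finset.sum_le_sum fun j _ => hAa t i j).trans
      (Finset.single_le_sum (f := fun i => ∑ j, a i j) (fun i _ => hrow i) (Finset.mem_univ i))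
  have hK' : ∀ t i j, adjacency a (fun i => σ i t) i j ≤ ∑ i, ∑ j, a i j := fun t i j =>
    (Finset.single_le_sum (f := fun j => adjacency a (fun i => σ i t) i j) (fun j _ => hA t i j)
      (Finset.mem_univ j)).trans (hK t i)
  refine ⟨hasUniqueSolutions_closedLoop a hτ hσ R, ?_, ?_⟩
  · intro t₀ ε hε
    obtain ⟨d, hd, hdε⟩ := exists_scale n hε
    refine ⟨d / 4, by positivity, fun z hz h0 t ht => ?_⟩
    refine (infDist_consensusSet_le (d := d) fun k => ?_).trans hdε
    obtain ⟨m, hm⟩ := exists_mem_Icc_of_infDist_le c (by positivity) h0 k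
    rw [mul_div_cancel₀ d (by norm_num : (4 : ℝ) ≠ 0)] at hm
    exact ⟨m, (isConsensusSolution_of_isSolution hz k).mem_Icc hA hK' hm ht⟩
  · intro t₀ z hz
    refine Metric.tendsto_atTop.2 fun ε hε => ?_
    obtain ⟨d, hd, hdε⟩ := exists_scale n (half_pos hε)
    choose t₁ ht₁ using fun k : Fin 3 =>
      (isConsensusSolution_of_isSolution hz k).exists_forall_mem_Icc hA hK
        (Finset.sum_nonneg fun i _ => hrow i) (ha i₀ j₀) (half_pos hτ)
        (by linarith : 0 ≤ S + τ) (exists_forall_hasInflow hτ hα hσ hconn) hd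
    refine ⟨∑ k, |t₁ k|, fun t ht => ?_⟩
    rw [Real.dist_0_eq_abs, abs_of_nonneg Metric.infDist_nonneg]
    refine ((infDist_consensusSet_le (d := d) fun k => ht₁ k t ?_).trans hdε).trans_lt
      (half_lt_self hε)
    exact (le_abs_self _).trans ((Finset.single_le_sum (f := fun k => |t₁ k|)
      (fun _ _ => abs_nonneg _) (Finset.mem_univ k)).trans ht)
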